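/- All graphs are finite and simple. A graph is $P_4$-sparse if every set of five vertices induces at most one chordless path $P_4$ on four vertices. For a graph $G$, a vertex $u$ of $G$ and a new vertex $w$, let $G+uw$ be $G$ together with $w$ and the single edge $uw$; write $\operatorname{fill}(G+uw)$ for the minimum number of further edges (so not counting $uw$) that have to be added to $G+uw$ to make it $P_4$-sparse. A spider is a graph whose vertex set is partitioned into sets $S,K,R$ ($R$ possibly empty) with $S$ independent, $K$ a clique, $|S|=|K|\ge 2$, every vertex of $R$ adjacent to all of $K$ and to none of $S$, and with a bijection $f:S\to K$ such that either $N(s)\cap K=\{f(s)\}$ for all $s\in S$ (thin spider), or $|K|\ge 3$ and $N(s)\cap K=K\setminus\{f(s)\}$ for all $s\in S$ (thick spider). The $P_4$-sparse tree of a $P_4$-sparse graph $G$ is the rooted tree whose leaves are the vertices of $G$, whose internal nodes have at least two children each and are labelled $0$, $1$ or $2$, where no $0$-node has a $0$-node as parent and no $1$-node has a $1$-node as parent, where two vertices whose least common ancestor is a $0$-node ($1$-node) are non-adjacent (adjacent), and where the leaves below each $2$-node induce a spider $(S,K,R)$, the children of the $2$-node being the leaves of $S\cup K$ and, if $R\neq\emptyset$,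 the root of one subtree with leaf set $R$. Let $G$ be a $P_4$-sparse graph, $u$ a vertex of $G$, and $t_0t_1\cdots t_hu$ the path in the $P_4$-sparse tree of $G$ from the root $t_0$ to the leaf $u$. For $0\le i\le h$ let $V_i$ be the set of leaves of the subtrees rooted at the children of $t_i$ other than the next node of the path. Suppose that the parent $t_h$ of $u$ is a $2$-node, corresponding to the spider $H=(S,K,R)$. Define $f_H$ as follows, where $f'=\operatorname{fill}(G[R]+uw)$ if $u\in R$. If $H$ is thin: - if $u\in S$, then $f_H=|K|-1$ if $R=\emptyset$, and $f_H=|K|$ otherwise; - if $u\in K$, then $f_H=|K|-1$; - if $u\in R$, then $f_H=\min\{\,|R\setminus N_G[u]|,\ |K|+f'\,\}$. If $H$ is thick: - if $u\in S$ and $|K|=3$, then $f_H=2$ if $R=\emptyset$, $f_H=3$ if $|R|=1$, and $f_H=4$ if $|R|\ge 2$; - if $u\in S$ and $|K|\ge 4$, then $f_H=|K|$ if $R=\emptyset$, and $f_H=|K|+1$ otherwise; - if $u\in K$, then $f_H=1$; - if $u\in R$, then $f_H=|K|+f'$. Then $\operatorname{fill}(G+uw)$ is at most the minimum of the two numbers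 (i) $f_H+|N_G(u)\cap(V_0\cup\cdots\cup V_{h-1})|$, and (ii) $\displaystyle\min_{0\le i\le h,\ t_i\text{ a }1\text{- or }2\text{-node}}\Bigl\{|N_G(u)\cap(V_0\cup\cdots\cup V_{i-1})|+|(V_i\cup\cdots\cup V_h)\setminus N_G(u)|\Bigr\}$. -/

import Mathlib

/-- The vertex set `Y` induces a chordless path on four vertices in `G`. -/
def InducesP4 {V : Type*} (G : SimpleGraph V) (Y : Set V) : Prop :=
  Nonempty (G.induce Y ≃g SimpleGraph.pathGraph 4)

/-- `G` is `P₄`-sparse: every set of five vertices induces at most one `P₄`. -/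
def IsP4Sparse {V : Type*} (G : SimpleGraph V) : Prop :=
  ∀ X : Set V, X.ncard = 5 → ∀ Y Z : Set V, Y ⊆ X → Z ⊆ X →
    InducesP4 G Y → InducesP4 G Z → Y = Z

/-- The graph `G + uw`: the new vertex `w` is `none`, and it is joined to `u` only. -/
def addTail {V : Type*} (G : SimpleGraph V) (u : V) : SimpleGraph (Option V) :=
  G.map Function.Embedding.some ⊔ SimpleGraph.edge (some u) none

/-- `n` is the number of fill edges of some `P₄`-sparse completion of `H`. -/
def IsFillCount {W : Type*} (H : SimpleGraph W) (n : ℕ) : Prop :=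
  ∃ F : SimpleGraph W, H ≤ F ∧ IsP4Sparse F ∧ (F.edgeSet \ H.edgeSet).ncard = n

/-- The number of fill edges in a minimum `P₄`-sparse completion of `H`. -/
noncomputable def minFill {W : Type*} (H : SimpleGraph W) : ℕ :=
  sInf {n | IsFillCount H n}

theorem isP4Sparse_top {W : Type*} : IsP4Sparse (⊤ : SimpleGraph W) := by
  rintro X - Y Z - - ⟨e⟩ -
  exfalso
  have h1 : (e.symm 0) ≠ (e.symm 2) := fun h => by
    have := e.symm.injective h
    revert this; decide
  have h2 : ((⊤ : SimpleGraph W).induce Y).Adj (e.symm 0) (e.symm 2) := by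
    simp [h1, -EmbeddingLike.apply_eq_iff_eq]
  rw [e.symm.map_adj_iff, SimpleGraph.pathGraph_adj] at h2
  revert h2; decide

/-- The minimum in `minFill` is attained by a completion. -/
theorem isFillCount_minFill {W : Type*} (H : SimpleGraph W) : IsFillCount H (minFill H) :=
  Nat.sInf_mem (s := {n | IsFillCount H n}) ⟨_, ⊤, le_top, isP4Sparse_top, rfl⟩

/-- What thin and thick spiders have in common: `S` is independent, `K` is a clique,
`|S| = |K| ≥ 2`, and each vertex of `R` sees all of `K` and nothing of `S`. -/
structure IsSpiderBase {V : Type*} (G : SimpleGraph V) (S K R : Set V) : Prop where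
  disjoint_SK : Disjoint S K
  disjoint_SR : Disjoint S R
  disjoint_KR : Disjoint K R
  indep : G.IsIndepSet S
  clique : G.IsClique K
  card_eq : S.ncard = K.ncard
  two_le : 2 ≤ K.ncard
  adj_RK : ∀ r ∈ R, ∀ k ∈ K, G.Adj r k
  not_adj_RS : ∀ r ∈ R, ∀ s ∈ S, ¬ G.Adj r s

/-- The subgraph of `G` induced by `S ∪ K ∪ R` is a thin spider with this partition. -/
def IsThinSpider {V : Type*} (G : SimpleGraph V) (S K R : Set V) : Prop :=
  IsSpiderBase G S K R ∧ ∃ f : S ≃ K, ∀ (s : S) (k : K), G.Adj s k ↔ k = f s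

/-- The subgraph of `G` induced by `S ∪ K ∪ R` is a thick spider with this partition
(`|K| ≥ 3`, since for `|K| = 2` the spider counts as thin). -/
def IsThickSpider {V : Type*} (G : SimpleGraph V) (S K R : Set V) : Prop :=
  IsSpiderBase G S K R ∧ 3 ≤ K.ncard ∧
    ∃ f : S ≃ K, ∀ (s : S) (k : K), G.Adj s k ↔ k ≠ f s

def IsSpider {V : Type*} (G : SimpleGraph V) (S K R : Set V) : Prop :=
  IsThinSpider G S K R ∨ IsThickSpider G S K R

/-- The number `f'` of fill edges in a minimum `P₄`-sparse completion of `G[R] + uw`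
(used only for `u ∈ R`). -/
noncomputable def bodyFill {V : Type*} (G : SimpleGraph V) (R : Set V) (u : V) : ℕ :=
  open Classical in
  if h : u ∈ R then minFill (addTail (G.induce R) ⟨u, h⟩) else 0

/-- The number of fill edges for a tail at the vertex `u` of a thin spider `(S, K, R)`. -/
noncomputable def thinTailValue {V : Type*} (G : SimpleGraph V) (S K R : Set V) (u : V) : ℕ :=
  open Classical in
  if u ∈ S then
    if R = ∅ then K.ncard - 1 else K.ncard
  else if u ∈ K then K.ncard - 1
  else min (R \ insert u (G.neighborSet u)).ncard (K.ncard + bodyFill G R u)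

/-- The number of fill edges for a tail at the vertex `u` of a thick spider `(S, K, R)`. -/
noncomputable def thickTailValue {V : Type*} (G : SimpleGraph V) (S K R : Set V) (u : V) : ℕ :=
  open Classical in
  if u ∈ S then
    if K.ncard = 3 then
      if R = ∅ then K.ncard - 1
      else if R.ncard = 1 then K.ncard
      else K.ncard + 1
    else
      if R = ∅ then K.ncard else K.ncard + 1
  else if u ∈ K then 1
  else K.ncard + bodyFill G R u

/-- The number of fill edges for a tail at the vertex `u` of a spider `(S, K, R)`. -/
noncomputable def spiderTailValue {V : Type*} (G : SimpleGraph V) (S K R : Set V) (u : V) : ℕ :=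
  open Classical in
  if IsThinSpider G S K R then thinTailValue G S K R u else thickTailValue G S K R u

/-- Labels `0`, `1`, `2` of the internal nodes of a `P₄`-sparse tree. -/
inductive NodeLabel
  | zero
  | one
  | two

/-- Rooted trees with leaves in `V` and labelled internal nodes; a tree stands for its root. -/
inductive LTree (V : Type*)
  | leaf (v : V) : LTree V
  | node (l : NodeLabel) (n : ℕ) (c : Fin n → LTree V) : LTree V

namespace LTree

/-- The list of the leaves of a tree, from left to right. -/
def leaves {V : Type*} : LTree V → List V
  | leaf v => [v]
  | node _ _ c => (List.ofFn fun i => leaves (c i)).flatten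

/-- The set of vertices associated with the leaves of a tree. -/
def verts {V : Type*} (t : LTree V) : Set V := {v | v ∈ t.leaves}

/-- `IsChild s t`: the root of `s` is a child of the root of `t`. -/
def IsChild {V : Type*} (s : LTree V) : LTree V → Prop
  | leaf _ => False
  | node _ _ c => ∃ i, c i = s

/-- `IsSubtree s t`: `s` is the subtree of `t` rooted at some node of `t`. -/
def IsSubtree {V : Type*} (s t : LTree V) : Prop := Relation.ReflTransGen IsChild s t

/-- The root of `t` is an internal node with label `l`. -/
def HasLabel {V : Type*} (t : LTree V) (l : NodeLabel) : Prop := ∃ n c, t = node l n c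

end LTree

/-- A `2`-node with children `c i` corresponds to the spider `(S, K, R)` of `G`: its children are
the leaves for the vertices of `S ∪ K` and, if `R` is non-empty, the root of a subtree for `R`. -/
structure IsSpiderNode {V : Type*} (G : SimpleGraph V) (t : LTree V) (S K R : Set V) : Prop where
  label : t.HasLabel NodeLabel.two
  spider : IsSpider G S K R
  leaf_child : ∀ v ∈ S ∪ K, (LTree.leaf v).IsChild t
  body_child : R.Nonempty → ∃ s : LTree V, s.IsChild t ∧ s.verts = R
  child : ∀ s : LTree V, s.IsChild t →
    (∃ v ∈ S ∪ K, s = LTree.leaf v) ∨ (R.Nonempty ∧ s.verts = R)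

/-- `T` is the `P₄`-sparse tree of `G`. The least common ancestor of two leaves is the node below
which they lie in the subtrees of two different children. -/
structure IsP4SparseTree {V : Type*} (G : SimpleGraph V) (T : LTree V) : Prop where
  leaves_nodup : T.leaves.Nodup
  mem_leaves : ∀ v : V, v ∈ T.leaves
  two_le_children : ∀ l n c, (LTree.node l n c).IsSubtree T → 2 ≤ n
  label_ne : ∀ s t : LTree V, t.IsSubtree T → s.IsChild t → ∀ l l' : NodeLabel,
    s.HasLabel l → t.HasLabel l' → l ≠ NodeLabel.two → l' ≠ l
  zero_node : ∀ n c, (LTree.node NodeLabel.zero n c).IsSubtree T → ∀ i j, i ≠ j →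
    ∀ x ∈ (c i).verts, ∀ y ∈ (c j).verts, ¬ G.Adj x y
  one_node : ∀ n c, (LTree.node NodeLabel.one n c).IsSubtree T → ∀ i j, i ≠ j →
    ∀ x ∈ (c i).verts, ∀ y ∈ (c j).verts, G.Adj x y
  two_node : ∀ t : LTree V, t.IsSubtree T → t.HasLabel NodeLabel.two →
    ∃ S K R, IsSpiderNode G t S K R

/-- `t 0, …, t h` and then the leaf for `u` form the path of `T` from its root to that leaf
(the values `t i` with `i > h + 1` are irrelevant). -/
structure IsRootPath {V : Type*} (T : LTree V) (u : V) (h : ℕ) (t : ℕ → LTree V) : Prop where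
  root : t 0 = T
  step : ∀ i ≤ h, (t (i + 1)).IsChild (t i)
  last : t (h + 1) = LTree.leaf u

/-- The set `V_i`: vertices of the subtrees rooted at the children of `t i` other than the next
node `t (i + 1)` of the path. -/
def sideSet {V : Type*} (t : ℕ → LTree V) (i : ℕ) : Set V :=
  {v | ∃ s : LTree V, s.IsChild (t i) ∧ s ≠ t (i + 1) ∧ v ∈ s.verts}

/-- `|N(u) ∩ (V_0 ∪ ⋯ ∪ V_{i-1})|`. -/
noncomputable def outerCost {V : Type*} (G : SimpleGraph V) (u : V) (t : ℕ → LTree V)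
    (i : ℕ) : ℕ :=
  (G.neighborSet u ∩ ⋃ j < i, sideSet t j).ncard

/-- `|(V_i ∪ ⋯ ∪ V_h) \ N(u)|`. -/
noncomputable def innerCost {V : Type*} (G : SimpleGraph V) (u : V) (t : ℕ → LTree V)
    (h i : ℕ) : ℕ :=
  ((⋃ j ∈ Set.Icc i h, sideSet t j) \ G.neighborSet u).ncard

/-! Each bound comes from an explicit completion, built inside one set of leaves and then extended.
For every `i ≤ h` the leaves `M` below `t i` form a module of `G` with at least two vertices.
Suppose `G[M] + uw` is made `P₄`-sparse by `n` edges inside `M ∪ {w}`. Joining `w` also to the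
neighbours of `u` outside `M` makes `M ∪ {w}` a module again. A `P₄` crossing its boundary meets it
in exactly one vertex; projecting `w` to `u` turns it into a `P₄` of `G` meeting `M` in one vertex,
and exchanging that vertex for another vertex of `M` gives two `P₄`s on five vertices of `G`. So no
`P₄` crosses, and two `P₄`s on different sides span eight vertices. This is
`HasLocalFill.minFill_le`, with total cost `n + |N(u) \ M|`.

For (ii), `u` is made universal in `M ∪ {w}` (`hasLocalFill_universal`). For (i), `M` is the spider
`H`, and each case of `f_H` has its own completion (`hasLocalFill_spiderTailValue`). Since `u` is a
child of the 2-node, `u ∈ R` forces `R = {u}`. Sparsity of these completions is assembled from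
universal vertices, disjoint unions, split graphs with a matching, and bodies attached to split
graphs. -/

/-! ### Chordless paths as vertex tuples -/

/-- `a b c d` is a chordless path of `G`, in this order (the vertices are then distinct). -/
structure IsPathTuple {W : Type*} (G : SimpleGraph W) (a b c d : W) : Prop where
  ab : G.Adj a b
  bc : G.Adj b c
  cd : G.Adj c d
  ac : ¬ G.Adj a c
  bd : ¬ G.Adj b d
  ad : ¬ G.Adj a d

namespace IsPathTuple

variable {W : Type*} {G : SimpleGraph W} {a b c d : W}

theorem reverse (h : IsPathTuple G a b c d) : IsPathTuple G d c b a :=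
  ⟨h.cd.symm, h.bc.symm, h.ab.symm, fun h' => h.bd h'.symm, fun h' => h.ac h'.symm,
    fun h' => h.ad h'.symm⟩

theorem distinct (h : IsPathTuple G a b c d) :
    a ≠ b ∧ a ≠ c ∧ a ≠ d ∧ b ≠ c ∧ b ≠ d ∧ c ≠ d := by
  obtain ⟨h1, h2, h3, h4, h5, h6⟩ := h
  refine ⟨h1.ne, ?_, ?_, h2.ne, ?_, h3.ne⟩
  · rintro rfl; exact h6 h3
  · rintro rfl; exact h4 h3.symm
  · rintro rfl; exact h6 h1

theorem ncard_eq (h : IsPathTuple G a b c d) : ({a, b, c, d} : Set W).ncard = 4 := by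
  classical
  obtain ⟨h1, h2, h3, h4, h5, h6⟩ := h.distinct
  have : ({a, b, c, d} : Set W) = (({a, b, c, d} : Finset W) : Set W) := by simp
  rw [this, Set.ncard_coe_finset]
  simp [*]

end IsPathTuple

theorem inducesP4_iff {W : Type*} {G : SimpleGraph W} {Y : Set W} :
    InducesP4 G Y ↔ ∃ a b c d, IsPathTuple G a b c d ∧ Y = {a, b, c, d} := by
  constructor
  · rintro ⟨e⟩
    have key : ∀ i j : Fin 4, G.Adj (e.symm i) (e.symm j) ↔ (SimpleGraph.pathGraph 4).Adj i j :=
      fun i j => e.symm.map_adj_iff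
    refine ⟨e.symm 0, e.symm 1, e.symm 2, e.symm 3, ⟨?_, ?_, ?_, ?_, ?_, ?_⟩, ?_⟩
    any_goals rw [key, SimpleGraph.pathGraph_adj]; decide
    ext y
    constructor
    · intro hy
      have h1 : y = (e.symm (e ⟨y, hy⟩) : W) := by simp
      generalize e ⟨y, hy⟩ = i at h1
      fin_cases i <;> simp at h1 <;> simp [h1]
    · rintro (h | h | h | h) <;> rw [h] <;> exact Subtype.coe_prop _
  · rintro ⟨a, b, c, d, h, rfl⟩
    obtain ⟨h1, h2, h3, h4, h5, h6⟩ := h.distinct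
    have hinj : Function.Injective ![a, b, c, d] := by
      intro i j
      fin_cases i <;> fin_cases j <;> simp [*, Ne.symm, eq_comm]
    have hr : Set.range ![a, b, c, d] = {a, b, c, d} := by
      ext x; simp [eq_comm]; tauto
    rw [← hr]
    refine ⟨(⟨Equiv.ofInjective _ hinj, ?_⟩ :
      SimpleGraph.pathGraph 4 ≃g G.induce (Set.range ![a, b, c, d])).symm⟩
    obtain ⟨p1, p2, p3, p4, p5, p6⟩ := h
    intro i j
    rw [SimpleGraph.pathGraph_adj]
    fin_cases i <;> fin_cases j <;>
      simp [p1, p2, p3, p4, p5, p6, p1.symm, p2.symm, p3.symm, G.adj_comm c a, G.adj_comm d b,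
        G.adj_comm d a]

theorem IsPathTuple.inducesP4 {W : Type*} {G : SimpleGraph W} {a b c d : W}
    (h : IsPathTuple G a b c d) : InducesP4 G {a, b, c, d} :=
  inducesP4_iff.2 ⟨a, b, c, d, h, rfl⟩

theorem InducesP4.ncard_eq {W : Type*} {G : SimpleGraph W} {Y : Set W} (h : InducesP4 G Y) :
    Y.ncard = 4 := by
  obtain ⟨a, b, c, d, hp, rfl⟩ := inducesP4_iff.1 h
  exact hp.ncard_eq

theorem InducesP4.finite {W : Type*} {G : SimpleGraph W} {Y : Set W} (h : InducesP4 G Y) :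
    Y.Finite :=
  Set.finite_of_ncard_pos (by rw [h.ncard_eq]; norm_num)

/-! ### Sparsity on a vertex set and its composition rules -/

/-- The subgraph of `G` induced by `A` is `P₄`-sparse. -/
def SparseOn {W : Type*} (G : SimpleGraph W) (A : Set W) : Prop :=
  ∀ Y Z : Set W, Y ⊆ A → Z ⊆ A → InducesP4 G Y → InducesP4 G Z → (Y ∪ Z).ncard ≤ 5 → Y = Z

/-- Two distinct `P₄`s span at least five vertices, so a union of at most five has exactly five and
serves as the set `X` of the definition. -/
theorem IsP4Sparse.sparseOn {W : Type*} {G : SimpleGraph W} (hG : IsP4Sparse G) (A : Set W) :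
    SparseOn G A := by
  intro Y Z _ _ hY hZ hc
  by_contra hne
  refine hne (hG (Y ∪ Z) ?_ Y Z Set.subset_union_left Set.subset_union_right hY hZ)
  have hss : Y ⊂ Y ∪ Z := by
    refine Set.subset_union_left.ssubset_of_ne fun h => hne ?_
    have hZY : Z ⊆ Y := by rw [h]; exact Set.subset_union_right
    exact (Set.eq_of_subset_of_ncard_le hZY (by rw [hY.ncard_eq, hZ.ncard_eq]) hY.finite).symm
  have := Set.ncard_lt_ncard hss (hY.finite.union hZ.finite)
  rw [hY.ncard_eq] at this
  omega

namespace SparseOn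

variable {W : Type*} {F : SimpleGraph W}

theorem isP4Sparse (h : SparseOn F Set.univ) : IsP4Sparse F := by
  intro X hX Y Z hYX hZX hY hZ
  refine h Y Z (Set.subset_univ _) (Set.subset_univ _) hY hZ ?_
  rw [← hX]
  exact Set.ncard_le_ncard (Set.union_subset hYX hZX) (Set.finite_of_ncard_pos (by omega))

theorem pair (x y : W) : SparseOn F {x, y} := by
  intro Y Z hYA _ hY _ _
  have h1 := Set.ncard_le_ncard hYA
  have h2 := Set.ncard_insert_le x {y}
  rw [hY.ncard_eq] at h1
  rw [Set.ncard_singleton] at h2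
  omega

theorem singleton (x : W) : SparseOn F {x} := by
  simpa using pair (F := F) x x

theorem image {V : Type*} {G : SimpleGraph V} {A : Set V} (h : SparseOn G A) {g : V → W}
    (hg : Function.Injective g) (hF : ∀ x ∈ A, ∀ y ∈ A, F.Adj (g x) (g y) ↔ G.Adj x y) :
    SparseOn F (g '' A) := by
  have key : ∀ Y, Y ⊆ g '' A → InducesP4 F Y → ∃ Y', Y' ⊆ A ∧ InducesP4 G Y' ∧ Y = g '' Y' := by
    intro Y hYA hY
    obtain ⟨a, b, c, d, hp, rfl⟩ := inducesP4_iff.1 hY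
    obtain ⟨a, ha, rfl⟩ := hYA (show a ∈ _ by simp)
    obtain ⟨b, hb, rfl⟩ := hYA (show b ∈ _ by simp)
    obtain ⟨c, hc, rfl⟩ := hYA (show c ∈ _ by simp)
    obtain ⟨d, hd, rfl⟩ := hYA (show d ∈ _ by simp)
    refine ⟨{a, b, c, d}, ?_, IsPathTuple.inducesP4 ?_, by simp [Set.image_insert_eq]⟩
    · rintro x (rfl | rfl | rfl | rfl) <;> assumption
    · obtain ⟨h1, h2, h3, h4, h5, h6⟩ := hp
      constructor <;> grind
  intro Y Z hYA hZA hY hZ hc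
  obtain ⟨Y', hY1, hY2, rfl⟩ := key Y hYA hY
  obtain ⟨Z', hZ1, hZ2, rfl⟩ := key Z hZA hZ
  rw [← Set.image_union, Set.ncard_image_of_injective _ hg] at hc
  rw [h Y' Z' hY1 hZ1 hY2 hZ2 hc]

theorem congr {F' : SimpleGraph W} {A : Set W} (h : SparseOn F A)
    (hF : ∀ x ∈ A, ∀ y ∈ A, F'.Adj x y ↔ F.Adj x y) : SparseOn F' A := by
  simpa using h.image (g := id) Function.injective_id hF

/-- If no chordless path on four vertices meets both `A` and `B`, sparsity can be checked
separately. -/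
theorem union {A B : Set W} (hA : SparseOn F A) (hB : SparseOn F B) (hAB : Disjoint A B)
    (h : ∀ a b c d, a ∈ A ∪ B → b ∈ A ∪ B → c ∈ A ∪ B → d ∈ A ∪ B → IsPathTuple F a b c d →
      (a ∈ A ∧ b ∈ A ∧ c ∈ A ∧ d ∈ A) ∨ (a ∈ B ∧ b ∈ B ∧ c ∈ B ∧ d ∈ B)) :
    SparseOn F (A ∪ B) := by
  have key : ∀ Y, Y ⊆ A ∪ B → InducesP4 F Y → Y ⊆ A ∨ Y ⊆ B := by
    intro Y hYA hY
    obtain ⟨a, b, c, d, hp, rfl⟩ := inducesP4_iff.1 hY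
    rcases h a b c d (hYA (by simp)) (hYA (by simp)) (hYA (by simp)) (hYA (by simp)) hp with
      ⟨h1, h2, h3, h4⟩ | ⟨h1, h2, h3, h4⟩
    · left; rintro x (rfl | rfl | rfl | rfl) <;> assumption
    · right; rintro x (rfl | rfl | rfl | rfl) <;> assumption
  -- Paths on different sides are disjoint, so together they have eight vertices.
  have cross : ∀ Y Z, Y ⊆ A → Z ⊆ B → InducesP4 F Y → InducesP4 F Z →
      ¬ (Y ∪ Z).ncard ≤ 5 := by
    intro Y Z hYA hZB hY hZ
    rw [Set.ncard_union_eq (hAB.mono hYA hZB) hY.finite hZ.finite, hY.ncard_eq, hZ.ncard_eq]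
    norm_num
  intro Y Z hYA hZA hY hZ hc
  rcases key Y hYA hY with h1 | h1 <;> rcases key Z hZA hZ with h2 | h2
  · exact hA Y Z h1 h2 hY hZ hc
  · exact absurd hc (cross Y Z h1 h2 hY hZ)
  · rw [Set.union_comm] at hc
    exact absurd hc (cross Z Y h2 h1 hZ hY)
  · exact hB Y Z h1 h2 hY hZ hc

/-- No vertex of a `P₄` is adjacent to the other three. -/
theorem insert_universal {A : Set W} {k : W} (hA : SparseOn F A) (hk : k ∉ A)
    (h : ∀ x ∈ A, F.Adj k x) : SparseOn F (insert k A) := by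
  rw [Set.insert_eq]
  refine (singleton k).union hA (by simpa using hk) ?_
  intro a b c d ha hb hc hd hp
  have h' : ∀ x ∈ A, F.Adj x k := fun x hx => (h x hx).symm
  have hd' := hp.distinct
  obtain ⟨h1, h2, h3, h4, h5, h6⟩ := hp
  simp only [Set.mem_union, Set.mem_singleton_iff] at *
  grind

/-- A `P₄` is connected, so it stays on one side. -/
theorem union_of_not_adj {A B : Set W} (hA : SparseOn F A) (hB : SparseOn F B)
    (hAB : Disjoint A B) (h : ∀ x ∈ A, ∀ y ∈ B, ¬ F.Adj x y) : SparseOn F (A ∪ B) := by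
  refine hA.union hB hAB ?_
  intro a b c d ha hb hc hd hp
  have h' : ∀ x ∈ B, ∀ y ∈ A, ¬ F.Adj x y := fun x hx y hy hxy => h y hy x hx hxy.symm
  obtain ⟨h1, h2, h3, h4, h5, h6⟩ := hp
  simp only [Set.mem_union] at *
  grind

/-- Adding a body `R` to a split graph `(S, K)`. -/
theorem union_body {S K R : Set W} (hSK : SparseOn F (S ∪ K)) (hR : SparseOn F R)
    (hdS : Disjoint S R) (hdK : Disjoint K R)
    (hS : ∀ x ∈ S, ∀ y ∈ S, ¬ F.Adj x y) (hK : ∀ x ∈ K, ∀ y ∈ K, x ≠ y → F.Adj x y)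
    (hRK : ∀ r ∈ R, ∀ k ∈ K, F.Adj r k) (hRS : ∀ r ∈ R, ∀ s ∈ S, ¬ F.Adj r s) :
    SparseOn F (S ∪ K ∪ R) := by
  refine hSK.union hR (Set.disjoint_union_left.2 ⟨hdS, hdK⟩) ?_
  intro a b c d ha hb hc hd hp
  have hRK' : ∀ k ∈ K, ∀ r ∈ R, F.Adj k r := fun k hk r hr => (hRK r hr k hk).symm
  have hRS' : ∀ s ∈ S, ∀ r ∈ R, ¬ F.Adj s r := fun s hs r hr h => hRS r hr s hs h.symm
  have hd' := hp.distinct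
  obtain ⟨h1, h2, h3, h4, h5, h6⟩ := hp
  simp only [Set.mem_union] at *
  -- A path meeting both `R` and `S ∪ K` meets the module `R` in a single vertex `r`. The path then
  -- lies in the split graph with independent side `S ∪ {r}`, so `r` is an end, yet it sees both
  -- midpoints.
  rcases ha with (ha | ha) | ha <;> rcases hb with (hb | hb) | hb <;>
    rcases hc with (hc | hc) | hc <;> rcases hd with (hd | hd) | hd <;> grind

/-- Split graphs `(S, K)` in which the edges between `S` and `K` form a matching. -/
theorem of_matching {S K : Set W} (hd : Disjoint S K)
    (hS : ∀ x ∈ S, ∀ y ∈ S, ¬ F.Adj x y) (hK : ∀ x ∈ K, ∀ y ∈ K, x ≠ y → F.Adj x y)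
    (hs : ∀ s ∈ S, ∀ k ∈ K, ∀ k' ∈ K, F.Adj s k → F.Adj s k' → k = k')
    (hk : ∀ k ∈ K, ∀ s ∈ S, ∀ s' ∈ S, F.Adj s k → F.Adj s' k → s = s') :
    SparseOn F (S ∪ K) := by
  -- In a split graph a `P₄` has its ends in the independent set and its midpoints in the clique.
  have form : ∀ a b c d, a ∈ S ∪ K → b ∈ S ∪ K → c ∈ S ∪ K → d ∈ S ∪ K →
      IsPathTuple F a b c d → a ∈ S ∧ b ∈ K ∧ c ∈ K ∧ d ∈ S := by
    intro a b c d ha hb hc hd hp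
    have hd' := hp.distinct
    obtain ⟨h1, h2, h3, h4, h5, h6⟩ := hp
    have h1' := h1.symm
    have h2' := h2.symm
    have h3' := h3.symm
    simp only [Set.mem_union] at *
    grind
  -- A `P₄` therefore consists of two matching edges, so two different ones differ in a whole
  -- matching edge and span at least six vertices.
  have partner : ∀ Y, Y ⊆ S ∪ K → InducesP4 F Y → ∀ y ∈ Y, ∃ p ∈ Y,
      (y ∈ S ∧ p ∈ K ∧ F.Adj y p) ∨ (y ∈ K ∧ p ∈ S ∧ F.Adj p y) := by
    intro Y hYA hY
    obtain ⟨a, b, c, d, hp, rfl⟩ := inducesP4_iff.1 hY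
    obtain ⟨ha, hb, hc, hd⟩ :=
      form a b c d (hYA (by simp)) (hYA (by simp)) (hYA (by simp)) (hYA (by simp)) hp
    rintro y (rfl | rfl | rfl | rfl)
    · exact ⟨b, by simp, Or.inl ⟨ha, hb, hp.ab⟩⟩
    · exact ⟨a, by simp, Or.inr ⟨hb, ha, hp.ab⟩⟩
    · exact ⟨d, by simp, Or.inr ⟨hc, hd, hp.cd.symm⟩⟩
    · exact ⟨c, by simp, Or.inl ⟨hd, hc, hp.cd.symm⟩⟩
  intro Y Z hYA hZA hY hZ hcard
  by_contra hne
  obtain ⟨z, hzZ, hzY⟩ : ∃ z ∈ Z, z ∉ Y := by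
    by_contra! hcon
    exact hne (Set.eq_of_subset_of_ncard_le hcon (by rw [hY.ncard_eq, hZ.ncard_eq])
      hY.finite).symm
  obtain ⟨p, hpZ, hp⟩ := partner Z hZA hZ z hzZ
  have hdis : ∀ x ∈ S, x ∉ K := fun x h1 h2 => Set.disjoint_left.1 hd h1 h2
  have hpY : p ∉ Y := by
    intro hpY
    obtain ⟨q, hqY, hq⟩ := partner Y hYA hY p hpY
    grind
  have hpz : p ≠ z := by grind
  have hsub : insert p (insert z Y) ⊆ Y ∪ Z := by
    rintro x (rfl | rfl | hx)
    exacts [Or.inr hpZ, Or.inr hzZ, Or.inl hx]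
  have h1 := Set.ncard_le_ncard hsub (hY.finite.union hZ.finite)
  rw [Set.ncard_insert_of_notMem (by simp [hpz, hpY]) (hY.finite.insert z),
    Set.ncard_insert_of_notMem hzY hY.finite, hY.ncard_eq] at h1
  omega

end SparseOn

/-! ### Modules and chordless paths -/

/-- `M` is a module of `G`: no vertex outside distinguishes two vertices of `M`. -/
def IsGraphModule {V : Type*} (G : SimpleGraph V) (M : Set V) : Prop :=
  ∀ v, v ∉ M → ∀ x ∈ M, ∀ y ∈ M, G.Adj v x → G.Adj v y

namespace IsP4Sparse

variable {V : Type*} {G : SimpleGraph V}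

/-- The form in which sparsity is used for exchanges: replacing vertices of a path by one further
vertex `x` stays within five vertices. -/
theorem eq_of_path_mem_path {a b c d x : V} (hG : IsP4Sparse G) {Y Z : Set V}
    (hY : InducesP4 G Y) (hZ : InducesP4 G Z) (hYe : Y = {a, b, c, d})
    (hZe : Z ⊆ insert x {a, b, c, d}) : Y = Z := by
  refine hG.sparseOn Set.univ Y Z (Set.subset_univ _) (Set.subset_univ _) hY hZ ?_
  have h1 : Y ∪ Z ⊆ insert x Y := by
    rw [hYe]; exact Set.union_subset (Set.subset_insert _ _) hZe
  have h2 := Set.ncard_le_ncard h1 (hY.finite.insert x)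
  have h3 := Set.ncard_insert_le x Y
  rw [hY.ncard_eq] at h3
  omega

/-- A non-trivial module does not contain exactly one vertex of a chordless path, as an end. -/
theorem not_module_end (hG : IsP4Sparse G) {M : Set V} (hM : IsGraphModule G M)
    {x : V} (hx : x ∈ M) {a b c d : V} (ha : a ∈ M) (hxa : x ≠ a) (hb : b ∉ M) (hc : c ∉ M)
    (hd : d ∉ M) : ¬ IsPathTuple G a b c d := by
  intro hp
  -- `x` and `a` look alike from outside `M`, so `x` can replace `a`.
  have hq : IsPathTuple G x b c d := by
    obtain ⟨h1, h2, h3, h4, h5, h6⟩ := hp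
    refine ⟨(hM b hb a ha x hx h1.symm).symm, h2, h3, fun h => h4 ?_, h5, fun h => h6 ?_⟩
    · exact (hM c hc x hx a ha h.symm).symm
    · exact (hM d hd x hx a ha h.symm).symm
  have h := hG.eq_of_path_mem_path hp.inducesP4 hq.inducesP4 (x := x) rfl (by grind)
  have hx' : x ∈ ({a, b, c, d} : Set V) := by rw [h]; simp
  rcases hx' with rfl | rfl | rfl | rfl <;> contradiction

/-- A non-trivial module does not contain exactly one vertex of a chordless path, as a
midpoint. -/
theorem not_module_mid (hG : IsP4Sparse G) {M : Set V} (hM : IsGraphModule G M)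
    {x : V} (hx : x ∈ M) {a b c d : V} (hb : b ∈ M) (hxb : x ≠ b) (ha : a ∉ M) (hc : c ∉ M)
    (hd : d ∉ M) : ¬ IsPathTuple G a b c d := by
  intro hp
  have hq : IsPathTuple G a x c d := by
    obtain ⟨h1, h2, h3, h4, h5, h6⟩ := hp
    refine ⟨hM a ha b hb x hx h1, (hM c hc b hb x hx h2.symm).symm, h3, h4, fun h => h5 ?_, h6⟩
    exact (hM d hd x hx b hb h.symm).symm
  have h := hG.eq_of_path_mem_path hp.inducesP4 hq.inducesP4 (x := x) rfl (by grind)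
  have hx' : x ∈ ({a, b, c, d} : Set V) := by rw [h]; simp
  rcases hx' with rfl | rfl | rfl | rfl <;> contradiction

end IsP4Sparse

/-! ### Completions of `G + uw` and their extension from a module -/

/-- The pairs joining `x` to the vertices of `A`. -/
def starPairs {W : Type*} (x : W) (A : Set W) : Set (Sym2 W) := (fun v => s(x, v)) '' A

theorem mem_starPairs {W : Type*} {x y z : W} {A : Set W} :
    s(y, z) ∈ starPairs x A ↔ (y = x ∧ z ∈ A) ∨ (z = x ∧ y ∈ A) := by
  simp only [starPairs, Set.mem_image, Sym2.eq_iff]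
  grind

theorem starPairs_sub {W : Type*} {x : W} {A B : Set W} (hx : x ∈ B) (hA : A ⊆ B) :
    ∀ e ∈ starPairs x A, ∀ y ∈ e, y ∈ B := by
  rintro _ ⟨v, hv, rfl⟩ y hy
  rcases Sym2.mem_iff.1 hy with rfl | rfl
  exacts [hx, hA hv]

theorem ncard_starPairs_le {W : Type*} [Finite W] (x : W) (A : Set W) :
    (starPairs x A).ncard ≤ A.ncard :=
  Set.ncard_image_le A.toFinite

/-- The graph `G + uw` with the additional edges `E`. -/
def tailWith {V : Type*} (G : SimpleGraph V) (u : V) (E : Set (Sym2 (Option V))) :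
    SimpleGraph (Option V) :=
  addTail G u ⊔ SimpleGraph.fromEdgeSet E

section tailWith

variable {V : Type*} {G : SimpleGraph V} {u : V} {E : Set (Sym2 (Option V))}

theorem addTail_adj_some_some {a b : V} :
    (addTail G u).Adj (some a) (some b) ↔ G.Adj a b := by
  have h : (Function.Embedding.some : V ↪ Option V) = (some : V → Option V) := rfl
  simp only [addTail, SimpleGraph.sup_adj, SimpleGraph.edge_adj, SimpleGraph.map_adj', h]
  simp
  exact fun h => h.ne

theorem addTail_adj_none_some {b : V} : (addTail G u).Adj none (some b) ↔ b = u := by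
  have h : (Function.Embedding.some : V ↪ Option V) = (some : V → Option V) := rfl
  simp only [addTail, SimpleGraph.sup_adj, SimpleGraph.edge_adj, SimpleGraph.map_adj', h]
  simp [eq_comm]

theorem tailWith_adj_some_some {a b : V} :
    (tailWith G u E).Adj (some a) (some b) ↔ G.Adj a b ∨ (s(some a, some b) ∈ E ∧ a ≠ b) := by
  simp [tailWith, addTail_adj_some_some]

theorem tailWith_adj_none_some {b : V} :
    (tailWith G u E).Adj none (some b) ↔ b = u ∨ s(none, some b) ∈ E := by
  simp [tailWith, addTail_adj_none_some]

theorem tailWith_adj_some_none {b : V} :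
    (tailWith G u E).Adj (some b) none ↔ b = u ∨ s(none, some b) ∈ E := by
  rw [SimpleGraph.adj_comm, tailWith_adj_none_some]

theorem tailWith_fill_subset :
    (tailWith G u E).edgeSet \ (addTail G u).edgeSet ⊆ E := by
  rintro e ⟨h1, h2⟩
  induction e with
  | _ x y =>
    rw [SimpleGraph.mem_edgeSet] at h1 h2
    rcases h1 with h1 | h1
    · exact absurd h1 h2
    · exact h1.1

/-- Loops in `E` and pairs that are already edges only weaken the bound, so `E` need not be the
exact set of fill edges. -/
theorem minFill_addTail_le [Finite V] (h : IsP4Sparse (tailWith G u E)) :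
    minFill (addTail G u) ≤ E.ncard :=
  have h' : IsFillCount (addTail G u) _ := ⟨tailWith G u E, le_sup_left, h, rfl⟩
  (Nat.sInf_le h').trans (Set.ncard_le_ncard tailWith_fill_subset)

end tailWith

/-- Within `M ∪ {w}`, the graph `G[M] + uw` becomes `P₄`-sparse by adding at most `n` edges. -/
def HasLocalFill {V : Type*} (G : SimpleGraph V) (u : V) (M : Set V) (n : ℕ) : Prop :=
  ∃ E : Set (Sym2 (Option V)), (∀ e ∈ E, ∀ x ∈ e, x ∈ insert none (some '' M)) ∧
    E.ncard ≤ n ∧ SparseOn (tailWith G u E) (insert none (some '' M))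

/-- A completion within a non-trivial module `M` containing `u` extends to `G + uw`: the new
vertex also gets the neighbours of `u` outside `M`. -/
theorem HasLocalFill.minFill_le {V : Type*} [Finite V] {G : SimpleGraph V} (hG : IsP4Sparse G)
    {u : V} {M : Set V} {n : ℕ} (hn : HasLocalFill G u M n) (hM : IsGraphModule G M)
    (hM2 : M.Nontrivial) (hu : u ∈ M) :
    minFill (addTail G u) ≤ n + (G.neighborSet u \ M).ncard := by
  obtain ⟨E, hE, hEn, hsp⟩ := hn
  set O : Set (Sym2 (Option V)) := starPairs none (some '' (G.neighborSet u \ M)) with hO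
  have hOn : O.ncard ≤ (G.neighborSet u \ M).ncard :=
    (ncard_starPairs_le _ _).trans (Set.ncard_image_le (Set.toFinite _))
  refine (minFill_addTail_le (E := E ∪ O) (SparseOn.isP4Sparse ?_)).trans
    ((Set.ncard_union_le _ _).trans (by omega))
  set F := tailWith G u (E ∪ O) with hF
  -- The projection sends `w` to `u`. Adjacencies of `F` with an endpoint outside `M ∪ {w}` are
  -- pulled back from `G` along it.
  set π : Option V → V := fun x => x.getD u with hπ
  have hmem : ∀ x, x ∈ insert none (some '' M) ↔ π x ∈ M := by
    rintro (_ | x) <;> simp [hπ, hu]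
  have hEx : ∀ x y, s(x, y) ∈ E → π x ∈ M ∧ π y ∈ M := fun x y h =>
    ⟨(hmem x).1 (hE _ h x (by simp)), (hmem y).1 (hE _ h y (by simp))⟩
  have hinj : ∀ x y, π y ∉ M → π x = π y → x = y := by
    rintro (_ | x) (_ | y) <;> simp [hπ] <;> grind
  have hadj' : ∀ x y, π y ∉ M → (F.Adj x y ↔ G.Adj (π x) (π y)) := by
    rintro (_ | x) (_ | y) hy
    · exact absurd hu hy
    · have h1 : s(none, some y) ∉ E := fun h => hy (hEx _ _ h).2
      have h2 : y ≠ u := by rintro rfl; exact hy hu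
      have h3 : y ∉ M := hy
      rw [hF, tailWith_adj_none_some]
      simp [hO, mem_starPairs, hπ, h1, h2, h3]
    · exact absurd hu hy
    · have h1 : s(some x, some y) ∉ E := fun h => hy (hEx _ _ h).2
      rw [hF, tailWith_adj_some_some]
      simp [hO, mem_starPairs, hπ, h1]
  have hadj : ∀ x y, π x ∉ M ∨ π y ∉ M → (F.Adj x y ↔ G.Adj (π x) (π y)) := by
    rintro x y (h | h)
    · rw [F.adj_comm, G.adj_comm]; exact hadj' y x h
    · exact hadj' x y h
  have huniv : (Set.univ : Set (Option V)) = insert none (some '' M) ∪ some '' Mᶜ := by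
    ext (_ | x) <;> simp [em]
  have hmemc : ∀ x, x ∈ some '' Mᶜ ↔ π x ∉ M := by
    rintro (_ | x) <;> simp [hπ, hu]
  rw [huniv]
  refine SparseOn.union (hsp.congr ?_) ((hG.sparseOn Mᶜ).image (Option.some_injective V) ?_) ?_ ?_
  · rintro (_ | x) hx (_ | y) hy
    · simp
    · rw [hF, tailWith_adj_none_some, tailWith_adj_none_some]
      have : y ∈ M := (hmem _).1 hy
      simp [hO, mem_starPairs, this]
    · rw [hF, tailWith_adj_some_none, tailWith_adj_some_none]
      have : x ∈ M := (hmem _).1 hx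
      simp [hO, mem_starPairs, this]
    · rw [hF, tailWith_adj_some_some, tailWith_adj_some_some]
      simp [hO, mem_starPairs]
  · intro x hx y _
    exact hadj (some x) (some y) (Or.inl hx)
  · rw [Set.disjoint_left]
    intro x hx hx'
    exact (hmemc x).1 hx' ((hmem x).1 hx)
  · intro a b c d _ _ _ _ hp
    rw [hmem, hmem, hmem, hmem, hmemc, hmemc, hmemc, hmemc]
    -- If only one vertex of the path lies in `M ∪ {w}`, every pair of path vertices has a member
    -- outside, so `π` maps the path to a path of `G`.
    have ends : ∀ a b c d, IsPathTuple F a b c d → π a ∈ M → π b ∉ M → π c ∉ M → π d ∉ M →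
        False := by
      intro a b c d hp ha hb hc hd
      obtain ⟨x, hx, hxa⟩ := hM2.exists_ne (π a)
      refine hG.not_module_end hM hx ha hxa hb hc hd ?_
      obtain ⟨h1, h2, h3, h4, h5, h6⟩ := hp
      rw [hadj] at h1 h2 h3 h4 h5 h6 <;> first | exact ⟨h1, h2, h3, h4, h5, h6⟩ | tauto
    have mids : ∀ a b c d, IsPathTuple F a b c d → π a ∉ M → π b ∈ M → π c ∉ M → π d ∉ M →
        False := by
      intro a b c d hp ha hb hc hd
      obtain ⟨x, hx, hxa⟩ := hM2.exists_ne (π b)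
      refine hG.not_module_mid hM hx hb hxa ha hc hd ?_
      obtain ⟨h1, h2, h3, h4, h5, h6⟩ := hp
      rw [hadj] at h1 h2 h3 h4 h5 h6 <;> first | exact ⟨h1, h2, h3, h4, h5, h6⟩ | tauto
    -- `M ∪ {w}` is a module of `F`, which rules out paths with two or three vertices in it.
    have twin : ∀ x y z, π x ∈ M → π y ∈ M → π z ∉ M → F.Adj x z → F.Adj y z := by
      intro x y z hx hy hz h
      rw [hadj' _ _ hz] at h ⊢
      exact (hM _ hz _ hx _ hy h.symm).symm
    have twin' : ∀ x y z, π x ∈ M → π y ∈ M → π z ∉ M → F.Adj z x → F.Adj z y :=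
      fun x y z hx hy hz h => (twin x y z hx hy hz h.symm).symm
    have e1 := ends a b c d hp
    have e2 := ends d c b a hp.reverse
    have e3 := mids a b c d hp
    have e4 := mids d c b a hp.reverse
    clear ends mids hadj hadj' hinj hmem hmemc hE hEx
    obtain ⟨h1, h2, h3, h4, h5, h6⟩ := hp
    have h1' := h1.symm
    have h2' := h2.symm
    have h3' := h3.symm
    have h4' : ¬ F.Adj c a := fun h => h4 h.symm
    have h5' : ¬ F.Adj d b := fun h => h5 h.symm
    have h6' : ¬ F.Adj d a := fun h => h6 h.symm
    by_cases ha : π a ∈ M <;> by_cases hb : π b ∈ M <;> by_cases hc : π c ∈ M <;>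
      by_cases hd : π d ∈ M <;> grind

/-- Once `u` is universal, deleting it leaves an induced subgraph of `G` and the isolated vertex
`w`. -/
theorem hasLocalFill_universal {V : Type*} [Finite V] {G : SimpleGraph V} (hG : IsP4Sparse G)
    {u : V} {M : Set V} (hu : u ∈ M) :
    HasLocalFill G u M (M \ insert u (G.neighborSet u)).ncard := by
  refine ⟨starPairs (some u) (some '' (M \ insert u (G.neighborSet u))), starPairs_sub ?_ ?_,
    (ncard_starPairs_le _ _).trans (Set.ncard_image_le (Set.toFinite _)), ?_⟩
  · simp [hu]
  · exact (Set.image_mono Set.sdiff_subset).trans (Set.subset_insert _ _)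
  · have hset : insert none (some '' M) = insert (some u) ({none} ∪ some '' (M \ {u})) := by
      ext (_ | x)
      · simp
      · simp; grind
    rw [hset]
    refine SparseOn.insert_universal (SparseOn.union_of_not_adj (SparseOn.singleton _)
      ((hG.sparseOn _).image (Option.some_injective V) ?_) ?_ ?_) ?_ ?_
    · rintro x ⟨hx, hxu⟩ y ⟨hy, hyu⟩
      rw [tailWith_adj_some_some]
      simp only [Set.mem_singleton_iff] at hxu hyu
      simp [mem_starPairs, hxu, hyu]
    · simp
    · rintro _ rfl _ ⟨y, ⟨hy, hyu⟩, rfl⟩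
      rw [tailWith_adj_none_some]
      simp only [Set.mem_singleton_iff] at hyu
      simp [mem_starPairs, hyu]
    · simp
    · rintro _ (rfl | ⟨y, ⟨hy, hyu⟩, rfl⟩)
      · rw [tailWith_adj_some_none]; simp
      · rw [tailWith_adj_some_some]
        simp only [Set.mem_singleton_iff] at hyu
        simp [mem_starPairs, hyu, hy, Ne.symm hyu]
        tauto

set_option linter.unusedSimpArgs false

theorem HasLocalFill.mono {V : Type*} {G : SimpleGraph V} {u : V} {M : Set V} {m n : ℕ}
    (h : HasLocalFill G u M m) (hmn : m ≤ n) : HasLocalFill G u M n := by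
  obtain ⟨E, h1, h2, h3⟩ := h
  exact ⟨E, h1, h2.trans hmn, h3⟩

/-! ### Completions inside a spider -/

section Spider

variable {V : Type*} {G : SimpleGraph V} {S K R : Set V} {u : V}

namespace IsSpiderBase

theorem not_adj_SS (hB : IsSpiderBase G S K R) : ∀ x ∈ S, ∀ y ∈ S, ¬ G.Adj x y := by
  intro x hx y hy h
  exact hB.indep hx hy h.ne h

theorem adj_KK (hB : IsSpiderBase G S K R) : ∀ x ∈ K, ∀ y ∈ K, x ≠ y → G.Adj x y :=
  fun _ hx _ hy hne => hB.clique hx hy hne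

end IsSpiderBase

/-- The legs and the clique of a thin spider are matched. -/
theorem IsThinSpider.exists_partner (h : IsThinSpider G S K R) :
    (∀ s ∈ S, ∃ k ∈ K, ∀ k' ∈ K, G.Adj s k' ↔ k' = k) ∧
    ∀ k ∈ K, ∃ s ∈ S, ∀ s' ∈ S, G.Adj s' k ↔ s' = s := by
  obtain ⟨-, f, hf⟩ := h
  refine ⟨fun s hs => ⟨f ⟨s, hs⟩, (f ⟨s, hs⟩).2, fun k' hk' => ?_⟩,
    fun k hk => ⟨f.symm ⟨k, hk⟩, (f.symm ⟨k, hk⟩).2, fun s' hs' => ?_⟩⟩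
  · rw [hf ⟨s, hs⟩ ⟨k', hk'⟩, Subtype.ext_iff]
  · rw [hf ⟨s', hs'⟩ ⟨k, hk⟩, ← Equiv.symm_apply_eq, eq_comm, Subtype.ext_iff]

/-- The legs and the clique of a thick spider are matched by non-adjacency. -/
theorem IsThickSpider.exists_partner (h : IsThickSpider G S K R) :
    (∀ s ∈ S, ∃ k ∈ K, ∀ k' ∈ K, G.Adj s k' ↔ k' ≠ k) ∧
    ∀ k ∈ K, ∃ s ∈ S, ∀ s' ∈ S, G.Adj s' k ↔ s' ≠ s := by
  obtain ⟨-, -, f, hf⟩ := h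
  refine ⟨fun s hs => ⟨f ⟨s, hs⟩, (f ⟨s, hs⟩).2, fun k' hk' => ?_⟩,
    fun k hk => ⟨f.symm ⟨k, hk⟩, (f.symm ⟨k, hk⟩).2, fun s' hs' => ?_⟩⟩
  · rw [hf ⟨s, hs⟩ ⟨k', hk'⟩, Ne, Ne, Subtype.ext_iff]
  · rw [hf ⟨s', hs'⟩ ⟨k, hk⟩, Ne, Ne, ← Equiv.symm_apply_eq, eq_comm, Subtype.ext_iff]

/-- Making `u` universal suffices: it misses only the `|S| - 1` legs other than its own. -/
theorem IsThinSpider.hasLocalFill_clique [Finite V] (hG : IsP4Sparse G) (h : IsThinSpider G S K R)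
    (hu : u ∈ K) : HasLocalFill G u (S ∪ K ∪ R) (K.ncard - 1) := by
  obtain ⟨s, hs, hs'⟩ := h.exists_partner.2 u hu
  refine (hasLocalFill_universal hG (by simp [hu])).mono ?_
  rw [← h.1.card_eq, ← Set.ncard_sdiff_singleton_of_mem hs]
  refine Set.ncard_le_ncard ?_
  rintro x ⟨(hx | hx) | hx, hxu⟩
  · refine ⟨hx, ?_⟩
    rintro rfl
    exact hxu (Or.inr ((hs' x hx).2 rfl).symm)
  · exfalso
    by_cases hux : u = x
    · exact hxu (Or.inl hux.symm)
    · exact hxu (Or.inr (h.1.adj_KK u hu x hx hux))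
  · exact absurd (Or.inr (h.1.adj_RK x hx u hu).symm) hxu

/-- Making `u` universal suffices: it misses a single leg. -/
theorem IsThickSpider.hasLocalFill_clique [Finite V] (hG : IsP4Sparse G) (h : IsThickSpider G S K R)
    (hu : u ∈ K) : HasLocalFill G u (S ∪ K ∪ R) 1 := by
  obtain ⟨s, hs, hs'⟩ := h.exists_partner.2 u hu
  refine (hasLocalFill_universal hG (by simp [hu])).mono ?_
  rw [← Set.ncard_singleton s]
  refine Set.ncard_le_ncard ?_
  rintro x ⟨(hx | hx) | hx, hxu⟩
  · by_contra hxs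
    exact hxu (Or.inr ((hs' x hx).2 hxs).symm)
  · exfalso
    by_cases hux : u = x
    · exact hxu (Or.inl hux.symm)
    · exact hxu (Or.inr (h.1.adj_KK u hu x hx hux))
  · exact absurd (Or.inr (h.1.adj_RK x hx u hu).symm) hxu

/-- Making `u` universal suffices: it misses the `|S| - 1` other legs and one clique vertex. -/
theorem IsThickSpider.hasLocalFill_leg_of_body_empty [Finite V] (hG : IsP4Sparse G)
    (h : IsThickSpider G S K R) (hu : u ∈ S) (hR : R = ∅) :
    HasLocalFill G u (S ∪ K ∪ R) K.ncard := by
  obtain ⟨k, hk, hk'⟩ := h.exists_partner.1 u hu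
  refine (hasLocalFill_universal hG (by simp [hu])).mono ?_
  have h1 := h.1.two_le
  have h2 := Set.ncard_sdiff_singleton_of_mem hu
  have h3 := Set.ncard_insert_le k (S \ {u})
  have h4 := h.1.card_eq
  refine (Set.ncard_le_ncard (t := insert k (S \ {u})) ?_).trans (by omega)
  rintro x ⟨(hx | hx) | hx, hxu⟩
  · exact Or.inr ⟨hx, fun h => hxu (Or.inl h)⟩
  · by_contra hxk
    exact hxu (Or.inr ((hk' x hx).2 fun h => hxk (Or.inl h)))
  · simp [hR] at hx

/-- Joining `u` to the rest of the clique lets `u` replace its neighbour `k` there, with `w` as its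
leg. Now `k` sees the whole new clique and no leg, so it becomes the body of a thin spider. -/
theorem IsThinSpider.hasLocalFill_leg_of_body_empty [Finite V] (h : IsThinSpider G S K R)
    (hu : u ∈ S) (hR : R = ∅) : HasLocalFill G u (S ∪ K ∪ R) (K.ncard - 1) := by
  obtain ⟨hp, hq⟩ := h.exists_partner
  obtain ⟨k, hk, hk'⟩ := hp u hu
  have hSS := h.1.not_adj_SS
  have hKK := h.1.adj_KK
  have hd := h.1.disjoint_SK
  have hdis : ∀ x ∈ S, x ∉ K := fun x h1 h2 => Set.disjoint_left.1 hd h1 h2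
  have hc : (some '' (K \ {k}) : Set (Option V)).ncard = K.ncard - 1 := by
    rw [Set.ncard_image_of_injective _ (Option.some_injective V),
      Set.ncard_sdiff_singleton_of_mem hk]
  refine ⟨starPairs (some u) (some '' (K \ {k})), starPairs_sub (by simp [hu]) ?_,
    hc ▸ ncard_starPairs_le _ _, ?_⟩
  · rintro _ ⟨x, ⟨hx, -⟩, rfl⟩; simp [hx]
  have hset : insert none (some '' (S ∪ K ∪ R)) =
      insert none (some '' (S \ {u})) ∪ some '' (insert u (K \ {k})) ∪ {some k} := by
    ext (_ | x)
    · simp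
    · simp [hR]; grind
  rw [hset]
  refine SparseOn.union_body (SparseOn.of_matching ?_ ?_ ?_ ?_ ?_) (SparseOn.singleton _)
    ?_ ?_ ?_ ?_ ?_ ?_
  all_goals simp only [Set.disjoint_left, Option.forall, Set.mem_insert_iff, Set.mem_image,
    Set.mem_singleton_iff, Set.mem_sdiff, tailWith_adj_some_some, tailWith_adj_none_some,
    tailWith_adj_some_none, mem_starPairs, SimpleGraph.irrefl, Option.some.injEq, reduceCtorEq,
    exists_eq_right, and_false, exists_false, or_false, false_or, true_or, or_true, false_and,
    IsEmpty.forall_iff, implies_true, true_and, and_true, forall_const]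
  all_goals grind [SimpleGraph.adj_comm]

/-- A tail at the only vertex of the body of a thin spider gives a thin spider. -/
theorem IsThinSpider.hasLocalFill_body [Finite V] (h : IsThinSpider G S K {u}) :
    HasLocalFill G u (S ∪ K ∪ {u}) 0 := by
  obtain ⟨hp, hq⟩ := h.exists_partner
  have hSS := h.1.not_adj_SS
  have hKK := h.1.adj_KK
  have hdis : ∀ x ∈ S, x ∉ K := fun x h1 h2 => Set.disjoint_left.1 h.1.disjoint_SK h1 h2
  have huS : u ∉ S := fun h1 => Set.disjoint_left.1 h.1.disjoint_SR h1 rfl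
  have huK : u ∉ K := fun h1 => Set.disjoint_left.1 h.1.disjoint_KR h1 rfl
  have hRK := h.1.adj_RK u rfl
  have hRS := h.1.not_adj_RS u rfl
  refine ⟨∅, by simp, by simp, ?_⟩
  have hset : insert none (some '' (S ∪ K ∪ {u})) =
      insert none (some '' S) ∪ some '' (insert u K) := by
    ext (_ | x)
    · simp
    · simp; grind
  rw [hset]
  refine SparseOn.of_matching ?_ ?_ ?_ ?_ ?_
  all_goals simp only [Set.disjoint_left, Option.forall, Set.mem_insert_iff, Set.mem_image,
    Set.mem_singleton_iff, Set.mem_sdiff, tailWith_adj_some_some, tailWith_adj_none_some,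
    tailWith_adj_some_none, Set.mem_empty_iff_false, SimpleGraph.irrefl, Option.some.injEq,
    reduceCtorEq, exists_eq_right, and_false, exists_false, or_false, false_or, true_or, or_true,
    false_and, IsEmpty.forall_iff, implies_true, true_and, and_true, forall_const]
  all_goals grind [SimpleGraph.adj_comm]

/-- The head of the leg `u` is made universal, so that `uw` becomes a separate component. -/
theorem IsThinSpider.hasLocalFill_leg [Finite V] (hG : IsP4Sparse G) (h : IsThinSpider G S K R)
    (hu : u ∈ S) : HasLocalFill G u (S ∪ K ∪ R) K.ncard := by
  obtain ⟨hp, hq⟩ := h.exists_partner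
  obtain ⟨k, hk, hk'⟩ := hp u hu
  have hSS := h.1.not_adj_SS
  have hKK := h.1.adj_KK
  have hRK := h.1.adj_RK
  have hRS := h.1.not_adj_RS
  have hdis : ∀ x ∈ S, x ∉ K := fun x h1 h2 => Set.disjoint_left.1 h.1.disjoint_SK h1 h2
  have hdS : ∀ x ∈ S, x ∉ R := fun x h1 h2 => Set.disjoint_left.1 h.1.disjoint_SR h1 h2
  have hdK : ∀ x ∈ K, x ∉ R := fun x h1 h2 => Set.disjoint_left.1 h.1.disjoint_KR h1 h2
  -- The new edges at `k` go to `w` and to the `|S| - 1` other legs.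
  have hc : (insert none (some '' (S \ {u})) : Set (Option V)).ncard ≤ K.ncard := by
    have h1 := Set.ncard_insert_le none (some '' (S \ {u}) : Set (Option V))
    rw [Set.ncard_image_of_injective _ (Option.some_injective V),
      Set.ncard_sdiff_singleton_of_mem hu] at h1
    have := h.1.card_eq
    have := h.1.two_le
    omega
  refine ⟨starPairs (some k) (insert none (some '' (S \ {u}))), starPairs_sub (by simp [hk]) ?_,
    (ncard_starPairs_le _ _).trans hc, ?_⟩
  · rintro _ (rfl | ⟨x, ⟨hx, -⟩, rfl⟩)
    · simp
    · simp [hx]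
  have hset : insert none (some '' (S ∪ K ∪ R)) =
      insert (some k) ({none, some u} ∪ some '' (S \ {u} ∪ K \ {k} ∪ R)) := by
    ext (_ | x)
    · simp
    · simp; grind
  rw [hset]
  refine SparseOn.insert_universal (SparseOn.union_of_not_adj (SparseOn.pair _ _)
    ((hG.sparseOn _).image (Option.some_injective V) ?_) ?_ ?_) ?_ ?_
  all_goals simp only [Set.disjoint_left, Option.forall, Set.mem_insert_iff, Set.mem_image,
    Set.mem_singleton_iff, Set.mem_sdiff, Set.mem_union, tailWith_adj_some_some,
    tailWith_adj_none_some, tailWith_adj_some_none, mem_starPairs, SimpleGraph.irrefl,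
    Option.some.injEq, reduceCtorEq, exists_eq_right, and_false, exists_false, or_false, false_or,
    true_or, or_true, false_and, IsEmpty.forall_iff, implies_true, true_and, and_true,
    forall_const]
  all_goals grind [SimpleGraph.adj_comm]

/-- The new vertex is joined to the clique, and so becomes a twin of the only vertex of the
body. -/
theorem IsThickSpider.hasLocalFill_body [Finite V] (hG : IsP4Sparse G)
    (h : IsThickSpider G S K {u}) : HasLocalFill G u (S ∪ K ∪ {u}) K.ncard := by
  have hSS := h.1.not_adj_SS
  have hKK := h.1.adj_KK
  have hdis : ∀ x ∈ S, x ∉ K := fun x h1 h2 => Set.disjoint_left.1 h.1.disjoint_SK h1 h2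
  have huS : u ∉ S := fun h1 => Set.disjoint_left.1 h.1.disjoint_SR h1 rfl
  have huK : u ∉ K := fun h1 => Set.disjoint_left.1 h.1.disjoint_KR h1 rfl
  have hRK := h.1.adj_RK u rfl
  have hRS := h.1.not_adj_RS u rfl
  refine ⟨starPairs none (some '' K), starPairs_sub (by simp) ?_,
    (ncard_starPairs_le _ _).trans (Set.ncard_image_le (Set.toFinite _)), ?_⟩
  · rintro _ ⟨x, hx, rfl⟩; simp [hx]
  have hset : insert none (some '' (S ∪ K ∪ {u})) =
      some '' S ∪ some '' K ∪ {none, some u} := by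
    ext (_ | x)
    · simp
    · simp
  rw [hset]
  refine SparseOn.union_body ?_ (SparseOn.pair _ _) ?_ ?_ ?_ ?_ ?_ ?_
  · rw [← Set.image_union]
    refine (hG.sparseOn _).image (Option.some_injective V) ?_
    simp [tailWith_adj_some_some, mem_starPairs]
  all_goals simp only [Set.disjoint_left, Option.forall, Set.mem_insert_iff, Set.mem_image,
    Set.mem_singleton_iff, Set.mem_sdiff, Set.mem_union, tailWith_adj_some_some,
    tailWith_adj_none_some, tailWith_adj_some_none, mem_starPairs, SimpleGraph.irrefl,
    Option.some.injEq, reduceCtorEq, exists_eq_right, and_false, exists_false, or_false, false_or,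
    true_or, or_true, false_and, IsEmpty.forall_iff, implies_true, true_and, and_true,
    forall_const]
  all_goals grind [SimpleGraph.adj_comm]

/-- The clique vertex missed by the leg `u` is made universal, and `u`, `w` move to the body. -/
theorem IsThickSpider.hasLocalFill_leg [Finite V] (hG : IsP4Sparse G) (h : IsThickSpider G S K R)
    (hu : u ∈ S) : HasLocalFill G u (S ∪ K ∪ R) (K.ncard + 1) := by
  obtain ⟨hp, hq⟩ := h.exists_partner
  obtain ⟨k, hk, hk'⟩ := hp u hu
  have hSS := h.1.not_adj_SS
  have hKK := h.1.adj_KK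
  have hRK := h.1.adj_RK
  have hRS := h.1.not_adj_RS
  have hdis : ∀ x ∈ S, x ∉ K := fun x h1 h2 => Set.disjoint_left.1 h.1.disjoint_SK h1 h2
  have hdS : ∀ x ∈ S, x ∉ R := fun x h1 h2 => Set.disjoint_left.1 h.1.disjoint_SR h1 h2
  have hdK : ∀ x ∈ K, x ∉ R := fun x h1 h2 => Set.disjoint_left.1 h.1.disjoint_KR h1 h2
  -- `w` needs all of `K`, while `u` lacks only `k`: `|K| + 1` edges.
  refine ⟨starPairs none (some '' K) ∪ starPairs (some u) {some k}, ?_, ?_, ?_⟩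
  · rintro e (he | he)
    · refine starPairs_sub (by simp) ?_ e he
      rintro _ ⟨x, hx, rfl⟩; simp [hx]
    · exact starPairs_sub (by simp [hu]) (by simp [hk]) e he
  · have h1 := (ncard_starPairs_le none (some '' K)).trans (Set.ncard_image_le (Set.toFinite _))
    have h2 := ncard_starPairs_le (some u) {some k}
    rw [Set.ncard_singleton] at h2
    exact (Set.ncard_union_le _ _).trans (by omega)
  have hset : insert none (some '' (S ∪ K ∪ R)) = insert (some k)
      (some '' (S \ {u}) ∪ some '' (K \ {k}) ∪ ({none, some u} ∪ some '' R)) := by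
    ext (_ | x)
    · simp
    · simp; grind
  rw [hset]
  refine SparseOn.insert_universal (SparseOn.union_body ?_ (SparseOn.union_of_not_adj
    (SparseOn.pair _ _) ((hG.sparseOn _).image (Option.some_injective V) ?_) ?_ ?_)
    ?_ ?_ ?_ ?_ ?_ ?_) ?_ ?_
  · rw [← Set.image_union]
    refine (hG.sparseOn _).image (Option.some_injective V) ?_
    simp [tailWith_adj_some_some, mem_starPairs]
    grind
  all_goals simp only [Set.disjoint_left, Option.forall, Set.mem_insert_iff, Set.mem_image,
    Set.mem_singleton_iff, Set.mem_sdiff, Set.mem_union, tailWith_adj_some_some,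
    tailWith_adj_none_some, tailWith_adj_some_none, mem_starPairs, SimpleGraph.irrefl,
    Option.some.injEq, reduceCtorEq, exists_eq_right, and_false, exists_false, or_false, false_or,
    true_or, or_true, false_and, IsEmpty.forall_iff, implies_true, true_and, and_true,
    forall_const]
  all_goals grind [SimpleGraph.adj_comm]

/-- The clique vertex missed by the leg `u` is made universal, and what remains becomes a thin
spider in which `u` belongs to the clique and `w` is its leg. -/
theorem IsThickSpider.hasLocalFill_leg_of_ncard_eq_three [Finite V] (hG : IsP4Sparse G)
    (h : IsThickSpider G S K R) (hu : u ∈ S) (hK : K.ncard = 3) :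
    HasLocalFill G u (S ∪ K ∪ R) (2 + R.ncard) := by
  obtain ⟨hp, hq⟩ := h.exists_partner
  obtain ⟨k, hk, hk'⟩ := hp u hu
  have hSS := h.1.not_adj_SS
  have hKK := h.1.adj_KK
  have hRK := h.1.adj_RK
  have hRS := h.1.not_adj_RS
  have hdis : ∀ x ∈ S, x ∉ K := fun x h1 h2 => Set.disjoint_left.1 h.1.disjoint_SK h1 h2
  have hdS : ∀ x ∈ S, x ∉ R := fun x h1 h2 => Set.disjoint_left.1 h.1.disjoint_SR h1 h2
  have hdK : ∀ x ∈ K, x ∉ R := fun x h1 h2 => Set.disjoint_left.1 h.1.disjoint_KR h1 h2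
  -- Here `|K| = 3` matters: `K \ {k}` has two vertices, and each leg other than `u` misses one of
  -- them, hence sees just the other. Without `k`, these legs are matched as in a thin spider.
  have hthree : ∀ a ∈ K, ∀ b ∈ K, ∀ c ∈ K, a ≠ k → b ≠ k → c ≠ k → a ≠ b → a ≠ c → b = c := by
    obtain ⟨x, y, z, -, -, -, rfl⟩ := Set.ncard_eq_three.1 hK
    simp only [Set.mem_insert_iff, Set.mem_singleton_iff] at *
    clear hSS hKK hRK hRS hdis hdS hdK hp hq hk'
    grind
  have hmiss : ∀ s ∈ S, s ≠ u → ∃ b ∈ K, b ≠ k ∧ ∀ k' ∈ K, G.Adj s k' ↔ k' ≠ b := by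
    intro s hs hsu
    obtain ⟨b, hb, hb'⟩ := hp s hs
    refine ⟨b, hb, ?_, hb'⟩
    rintro rfl
    obtain ⟨s', -, hs''⟩ := hq b hb
    grind
  have hs1 : ∀ s ∈ S, s ≠ u → ∀ a ∈ K, a ≠ k → ∀ b ∈ K, b ≠ k → G.Adj s a → G.Adj s b →
      a = b := by
    intro s hs hsu a ha hak b hb hbk hsa hsb
    obtain ⟨c, hc, hck, hc'⟩ := hmiss s hs hsu
    exact hthree c hc a ha b hb hck hak hbk ((hc' a ha).1 hsa).symm ((hc' b hb).1 hsb).symm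
  have hs2 : ∀ a ∈ K, a ≠ k → ∀ s ∈ S, s ≠ u → ∀ s' ∈ S, s' ≠ u → G.Adj s a → G.Adj s' a →
      s = s' := by
    intro a ha hak s hs hsu s' hs' hsu' hsa hsa'
    obtain ⟨b, hb, hbk, hb'⟩ := hmiss s hs hsu
    obtain ⟨c, hc, hck, hc'⟩ := hmiss s' hs' hsu'
    have hbc := hthree a ha b hb c hc hak hbk hck ((hb' a ha).1 hsa) ((hc' a ha).1 hsa')
    subst hbc
    obtain ⟨t, -, ht⟩ := hq b hb
    grind
  -- Two edges make `k` universal, and `|R|` edges join `u`, as a clique vertex, to the body.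
  refine ⟨starPairs (some k) {none, some u} ∪ starPairs (some u) (some '' R), ?_, ?_, ?_⟩
  · rintro e (he | he)
    · refine starPairs_sub (by simp [hk]) ?_ e he
      rintro _ (rfl | rfl) <;> simp [hu]
    · refine starPairs_sub (by simp [hu]) ?_ e he
      rintro _ ⟨x, hx, rfl⟩; simp [hx]
  · have h1 := (ncard_starPairs_le (some u) (some '' R)).trans
      (Set.ncard_image_le (Set.toFinite _))
    have h2 := ncard_starPairs_le (some k) {none, some u}
    have h3 := Set.ncard_insert_le none {some u}
    rw [Set.ncard_singleton] at h3
    exact (Set.ncard_union_le _ _).trans (by omega)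
  have hset : insert none (some '' (S ∪ K ∪ R)) = insert (some k)
      (insert none (some '' (S \ {u})) ∪ some '' (insert u (K \ {k})) ∪ some '' R) := by
    ext (_ | x)
    · simp
    · simp; grind
  have hsk : ∀ s ∈ S, s ≠ u → G.Adj s k := by
    intro s hs hsu
    obtain ⟨b, -, hbk, hb⟩ := hmiss s hs hsu
    exact (hb k hk).2 hbk.symm
  rw [hset]
  clear hset hthree hmiss hp hq
  refine SparseOn.insert_universal (SparseOn.union_body (SparseOn.of_matching ?_ ?_ ?_ ?_ ?_)
    ((hG.sparseOn _).image (Option.some_injective V) ?_) ?_ ?_ ?_ ?_ ?_ ?_) ?_ ?_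
  all_goals simp only [Set.disjoint_left, Option.forall, Set.mem_insert_iff, Set.mem_image,
    Set.mem_singleton_iff, Set.mem_sdiff, Set.mem_union, tailWith_adj_some_some,
    tailWith_adj_none_some, tailWith_adj_some_none, mem_starPairs, SimpleGraph.irrefl,
    Option.some.injEq, reduceCtorEq, exists_eq_right, and_false, exists_false, or_false, false_or,
    true_or, or_true, false_and, IsEmpty.forall_iff, implies_true, true_and, and_true,
    forall_const]
  all_goals grind [SimpleGraph.adj_comm]

end Spider

/-! ### Modules and costs along the root path -/

namespace LTree

variable {V : Type*}

theorem mem_verts_node {l : NodeLabel} {n : ℕ} {c : Fin n → LTree V} {v : V} :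
    v ∈ (node l n c).verts ↔ ∃ i, v ∈ (c i).verts := by
  simp only [verts, leaves, Set.mem_ofPred_eq, List.mem_flatten, List.mem_ofFn]
  constructor
  · rintro ⟨_, ⟨i, rfl⟩, h⟩; exact ⟨i, h⟩
  · rintro ⟨i, h⟩; exact ⟨_, ⟨i, rfl⟩, h⟩

theorem verts_leaf (v : V) : (leaf v).verts = {v} := by
  ext; simp [verts, leaves]

theorem mem_verts_iff_of_isChild {s t : LTree V} (h : s.IsChild t) {v : V} :
    v ∈ t.verts ↔ ∃ s' : LTree V, s'.IsChild t ∧ v ∈ s'.verts := by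
  cases t with
  | leaf => exact h.elim
  | node l n c =>
    rw [mem_verts_node]
    constructor
    · rintro ⟨i, hi⟩; exact ⟨c i, ⟨i, rfl⟩, hi⟩
    · rintro ⟨_, ⟨i, rfl⟩, hi⟩; exact ⟨i, hi⟩

end LTree

theorem IsSpiderNode.verts_eq {V : Type*} {G : SimpleGraph V} {t : LTree V} {S K R : Set V}
    (hN : IsSpiderNode G t S K R) {s : LTree V} (hs : s.IsChild t) : t.verts = S ∪ K ∪ R := by
  ext v
  rw [LTree.mem_verts_iff_of_isChild hs]
  constructor
  · rintro ⟨s', hs', hv⟩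
    rcases hN.child s' hs' with ⟨x, hx, rfl⟩ | ⟨-, hR⟩
    · rw [LTree.verts_leaf] at hv
      obtain rfl := hv
      exact Or.inl hx
    · exact Or.inr (hR ▸ hv)
  · rintro (hv | hv)
    · exact ⟨_, hN.leaf_child v hv, by rw [LTree.verts_leaf]; rfl⟩
    · obtain ⟨s', hs', hR⟩ := hN.body_child ⟨v, hv⟩
      exact ⟨s', hs', hR ▸ hv⟩

theorem IsSpider.base {V : Type*} {G : SimpleGraph V} {S K R : Set V} (h : IsSpider G S K R) :
    IsSpiderBase G S K R :=
  h.elim (·.1) (·.1)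

/-- The leaves below a child form a module of the subgraph induced by the leaves below the
parent. -/
theorem IsP4SparseTree.child_module {V : Type*} {G : SimpleGraph V} {T : LTree V}
    (hT : IsP4SparseTree G T) {s t : LTree V} (ht : t.IsSubtree T) (hs : s.IsChild t) :
    ∀ v ∈ t.verts, v ∉ s.verts → ∀ x ∈ s.verts, ∀ y ∈ s.verts, G.Adj v x → G.Adj v y := by
  intro v hv hvs x hx y hy hvx
  cases t with
  | leaf => exact hs.elim
  | node l n c =>
    obtain ⟨i, rfl⟩ := hs
    obtain ⟨j, hj⟩ := LTree.mem_verts_node.1 hv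
    have hji : j ≠ i := by rintro rfl; exact hvs hj
    cases l with
    | zero => exact absurd hvx (hT.zero_node n c ht j i hji v hj x hx)
    | one => exact hT.one_node n c ht j i hji v hj y hy
    | two =>
      obtain ⟨S, K, R, hN⟩ := hT.two_node _ ht ⟨n, c, rfl⟩
      have hi : (c i).IsChild (LTree.node NodeLabel.two n c) := ⟨i, rfl⟩
      -- A single leaf is trivially a module; the body sees all of `K` and nothing of `S`.
      rcases hN.child _ hi with ⟨z, -, hz⟩ | ⟨-, hR⟩
      · rw [hz, LTree.verts_leaf] at hx hy
        obtain rfl := hx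
        obtain rfl := hy
        exact hvx
      · rw [hN.verts_eq hi] at hv
        rw [hR] at hx hy hvs
        rcases hv with (hv | hv) | hv
        · exact absurd hvx.symm (hN.spider.base.not_adj_RS x hx v hv)
        · exact (hN.spider.base.adj_RK y hy v hv).symm
        · exact absurd hv hvs

namespace IsRootPath

variable {V : Type*} {G : SimpleGraph V} {T : LTree V} {u : V} {h : ℕ} {t : ℕ → LTree V}

theorem isSubtree (ht : IsRootPath T u h t) : ∀ i ≤ h, (t i).IsSubtree T := by
  intro i
  induction i with
  | zero => intro _; rw [ht.root]; exact Relation.ReflTransGen.refl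
  | succ i ih =>
    intro hi
    exact (ih (by omega)).head (ht.step i (by omega))

theorem verts_succ_subset (ht : IsRootPath T u h t) {i : ℕ} (hi : i ≤ h) :
    (t (i + 1)).verts ⊆ (t i).verts := fun _ hv =>
  (LTree.mem_verts_iff_of_isChild (ht.step i hi)).2 ⟨_, ht.step i hi, hv⟩

theorem verts_subset (ht : IsRootPath T u h t) {i j : ℕ} (hij : i ≤ j) (hj : j ≤ h + 1) :
    (t j).verts ⊆ (t i).verts := by
  induction j, hij using Nat.le_induction with
  | base => exact subset_rfl
  | succ j _ ih => exact (ht.verts_succ_subset (by omega)).trans (ih (by omega))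

theorem mem_verts (ht : IsRootPath T u h t) {i : ℕ} (hi : i ≤ h + 1) : u ∈ (t i).verts :=
  ht.verts_subset hi le_rfl (by rw [ht.last, LTree.verts_leaf]; rfl)

/-- At the last node of the path above `v`, the vertex `v` lies below a child off the path. -/
theorem exists_mem_sideSet (ht : IsRootPath T u h t) {i j : ℕ} (hij : i ≤ j) (hj : j ≤ h + 1)
    {v : V} (hv : v ∈ (t i).verts) (hv' : v ∉ (t j).verts) :
    ∃ k, i ≤ k ∧ k < j ∧ v ∈ sideSet t k := by
  induction j, hij using Nat.le_induction with
  | base => exact absurd hv hv'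
  | succ j hij ih =>
    by_cases hvj : v ∈ (t j).verts
    · obtain ⟨s, hs, hvs⟩ :=
        (LTree.mem_verts_iff_of_isChild (ht.step j (by omega))).1 hvj
      exact ⟨j, hij, by omega, s, hs, by rintro rfl; exact hv' hvs, hvs⟩
    · obtain ⟨k, h1, h2, h3⟩ := ih (by omega) hvj
      exact ⟨k, h1, by omega, h3⟩

/-- The root carries all vertices, and a module of the graph induced by a module is a module of `G`.
-/
theorem isGraphModule (hT : IsP4SparseTree G T) (ht : IsRootPath T u h t) :
    ∀ i ≤ h, IsGraphModule G (t i).verts := by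
  intro i
  induction i with
  | zero =>
    intro _ v hv
    rw [ht.root] at hv
    exact absurd (hT.mem_leaves v) hv
  | succ i ih =>
    intro hi v hv x hx y hy hvx
    have hsub := ht.verts_succ_subset (i := i) (by omega)
    by_cases hvi : v ∈ (t i).verts
    · exact hT.child_module (ht.isSubtree i (by omega)) (ht.step i (by omega)) v hvi hv
        x hx y hy hvx
    · exact ih (by omega) v hvi x (hsub hx) y (hsub hy) hvx

theorem ncard_le_outerCost [Finite V] (hT : IsP4SparseTree G T) (ht : IsRootPath T u h t) {i : ℕ}
    (hi : i ≤ h) : (G.neighborSet u \ (t i).verts).ncard ≤ outerCost G u t i := by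
  refine Set.ncard_le_ncard ?_
  rintro v ⟨hv, hvi⟩
  have hv0 : v ∈ (t 0).verts := by rw [ht.root]; exact hT.mem_leaves v
  obtain ⟨k, -, hk, hvk⟩ := ht.exists_mem_sideSet (Nat.zero_le i) (by omega) hv0 hvi
  exact ⟨hv, Set.mem_biUnion (show k ∈ {j | j < i} from hk) hvk⟩

theorem ncard_le_innerCost [Finite V] (ht : IsRootPath T u h t) {i : ℕ} (hi : i ≤ h) :
    ((t i).verts \ insert u (G.neighborSet u)).ncard ≤ innerCost G u t h i := by
  refine Set.ncard_le_ncard ?_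
  rintro v ⟨hv, hvu⟩
  have hvh : v ∉ (t (h + 1)).verts := by
    rw [ht.last, LTree.verts_leaf]
    exact fun h => hvu (Or.inl h)
  obtain ⟨k, hk, hk', hvk⟩ := ht.exists_mem_sideSet (by omega) le_rfl hv hvh
  exact ⟨Set.mem_biUnion (show k ∈ Set.Icc i h from ⟨hk, by omega⟩) hvk,
    fun h => hvu (Or.inr h)⟩

end IsRootPath

/-! ### The spider bound and the final minimum -/

/-- A tail at `u` in a spider costs at most `spiderTailValue`; for `u` in the body it suffices to
consider a body consisting of `u`. -/
theorem hasLocalFill_spiderTailValue {V : Type*} [Finite V] {G : SimpleGraph V}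
    (hG : IsP4Sparse G) {S K R : Set V} {u : V} (hs : IsSpider G S K R)
    (hu : u ∈ S ∪ K ∨ R = {u}) :
    HasLocalFill G u (S ∪ K ∪ R) (spiderTailValue G S K R u) := by
  classical
  have hR : u ∉ S → u ∉ K → R = {u} := by
    intro h1 h2
    rcases hu with (h | h) | h
    exacts [absurd h h1, absurd h h2, h]
  unfold spiderTailValue
  split_ifs with hthin
  · unfold thinTailValue
    split_ifs with h1 h2 h3
    · exact hthin.hasLocalFill_leg_of_body_empty h1 h2
    · exact hthin.hasLocalFill_leg hG h1
    · exact hthin.hasLocalFill_clique hG h3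
    · obtain rfl := hR h1 h3
      exact hthin.hasLocalFill_body.mono (Nat.zero_le _)
  · have hthick : IsThickSpider G S K R := hs.resolve_left hthin
    unfold thickTailValue
    split_ifs with h1 h2 h3 h4 h5 h6
    · refine (hthick.hasLocalFill_leg_of_ncard_eq_three hG h1 h2).mono ?_
      simp [h3, h2]
    · refine (hthick.hasLocalFill_leg_of_ncard_eq_three hG h1 h2).mono ?_
      simp [h4, h2]
    · exact hthick.hasLocalFill_leg hG h1
    · exact hthick.hasLocalFill_leg_of_body_empty hG h1 h5
    · exact hthick.hasLocalFill_leg hG h1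
    · exact hthick.hasLocalFill_clique hG h6
    · obtain rfl := hR h1 h6
      exact (hthick.hasLocalFill_body hG).mono (Nat.le_add_right _ _)

theorem corollary1 {V : Type*} [Finite V] (G : SimpleGraph V) (hG : IsP4Sparse G)
    (T : LTree V) (hT : IsP4SparseTree G T)
    (u : V) (h : ℕ) (t : ℕ → LTree V) (ht : IsRootPath T u h t)
    (S K R : Set V) (hH : IsSpiderNode G (t h) S K R) :
    minFill (addTail G u) ≤
      min (spiderTailValue G S K R u + outerCost G u t h)
        (sInf {m : ℕ | ∃ i ≤ h,
          ((t i).HasLabel NodeLabel.one ∨ (t i).HasLabel NodeLabel.two) ∧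
            m = outerCost G u t i + innerCost G u t h i}) := by
  have hch := ht.step h le_rfl
  have hverts := hH.verts_eq hch
  -- Every `t i` lies above the spider and so contains its clique, which has at least two vertices.
  have hnt : ∀ i ≤ h, (t i).verts.Nontrivial := by
    intro i hi
    refine Set.Nontrivial.mono (s := K) ?_ ?_
    · have h2 := hH.spider.base.two_le
      exact (Set.one_lt_ncard_iff_nontrivial).1 (by omega)
    · refine Set.Subset.trans ?_ (ht.verts_subset hi (by omega))
      rw [hverts]
      exact fun x hx => Or.inl (Or.inr hx)
  have main : ∀ i ≤ h, ∀ n, HasLocalFill G u (t i).verts n →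
      minFill (addTail G u) ≤ n + outerCost G u t i := fun i hi n hn =>
    (hn.minFill_le hG (ht.isGraphModule hT i hi) (hnt i hi) (ht.mem_verts (by omega))).trans
      (Nat.add_le_add_left (ht.ncard_le_outerCost hT hi) n)
  refine le_min (main h le_rfl _ ?_) ?_
  · rw [hverts]
    refine hasLocalFill_spiderTailValue hG hH.spider ?_
    rw [ht.last] at hch
    rcases hH.child _ hch with ⟨v, hv, huv⟩ | ⟨-, hR⟩
    · cases huv
      exact Or.inl hv
    · rw [LTree.verts_leaf] at hR
      exact Or.inr hR.symm
  -- The infimum of the empty set would be `0`; the 2-node `t h` shows that the set is nonempty.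
  · refine le_csInf ⟨_, h, le_rfl, Or.inr hH.label, rfl⟩ ?_
    rintro m ⟨i, hi, -, rfl⟩
    rw [Nat.add_comm]
    exact main i hi _ ((hasLocalFill_universal hG (ht.mem_verts (by omega))).mono
      (ht.ncard_le_innerCost hi))
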